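/- **Setting.** Let $\mathfrak g$ be a complex Lie algebra, $U\mathfrak g$ its universal enveloping algebra with the cocommutative coproduct $\Delta$ and the counit $\varepsilon$; tensor products of algebras $B[[h]]$ are completed $h$-adically, all maps are extended $h$-linearly, and repeated indices are summed. Let $\rho$ be a finite-dimensional matrix representation of $\mathfrak g$, extended to $U\mathfrak g$. Let $\mathcal A_\pm$ be the Weyl (upper sign) or Clifford (lower sign) algebra over $\mathbb C$ with generators $a^i,a^+_i$ ($i$ running over the index set of $\rho$) and relations $$a^ia^j=\pm a^ja^i,\qquad a^+_ia^+_j=\pm a^+_ja^+_i,\qquad a^ia^+_j=\delta^i_j\mathbf 1\pm a^+_ja^i .$$ $U\mathfrak g$ acts on $\mathcal A_\pm$, elements $x\in\mathfrak g$ acting as the derivations with $x\triangleright a^+_i=\rho(x)^j_ia^+_j$ and $x\triangleright a^i=-\rho(x)^i_ja^j$; let $\sigma:U\mathfrak g\to\mathcal A_\pm$ be the algebra homomorphism with $\sigma(x)=\rho(x)^i_ja^+_ia^j$ for $x\in\mathfrak g$. An element $I\in\mathcal A_\pm[[h]]$ is $\mathfrak g$-invariant if $x\triangleright I=\varepsilon(x)I$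 for all $x\in U\mathfrak g$. **Minimal twists.** A twist is an element $\mathcal F\in U\mathfrak g[[h]]\otimes U\mathfrak g[[h]]$ with $\mathcal F=\mathbf 1\otimes\mathbf 1+O(h)$ and $(\varepsilon\otimes\mathrm{id})\mathcal F=\mathbf 1=(\mathrm{id}\otimes\varepsilon)\mathcal F$; its coassociator is $$\phi=[(\Delta\otimes\mathrm{id})\mathcal F^{-1}](\mathcal F^{-1}\otimes\mathbf 1)(\mathbf 1\otimes\mathcal F)[(\mathrm{id}\otimes\Delta)\mathcal F].$$ The twist is minimal if $\phi=\phi_m$, where one of the following holds. * Quasitriangular case: $\mathfrak g$ is simple and finite-dimensional, $t=\Delta(\mathcal C)-\mathbf 1\otimes\mathcal C-\mathcal C\otimes\mathbf 1$ for the quadratic Casimir $\mathcal C$ of a non-degenerate symmetric invariant form, and, with $\hbar=h/2\pi i$, $\phi_m=\hat g(x)^{-1}\check g(x)$ for $0<x<1$, where $\hat g,\check g$ are the $U\mathfrak g^{\otimes3}[[h]]$-valued analytic solutions (the coefficient of each $h^n$ being an analytic function with values in a finite-dimensional subspace of $U\mathfrak g^{\otimes 3}$) of $$\frac{dg}{dx}=\hbar\Big(\frac{t_{12}}x+\frac{t_{23}}{x-1}\Big)g,\qquad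 0<x<1,$$ with $\hat g\,x^{-\hbar t_{12}}\to\mathbf 1^{\otimes 3}$ for $x\to0$ and $\check g\,(1-x)^{-\hbar t_{23}}\to\mathbf 1^{\otimes 3}$ for $x\to1$. * Triangular case: $\phi_m=\mathbf 1^{\otimes3}$. **Generators.** Let $u,\hat u,v,\hat v\in\mathcal A_\pm[[h]]$ be $\mathfrak g$-invariants of the form $\mathbf 1+O(h)$ and put $\mathsf a^i=u\,a^i\,\hat u$, $\mathsf a^+_i=v\,a^+_i\,\hat v$ (if $\rho$ is block diagonal, different invariants may be used for different blocks). For a minimal twist $\mathcal F=\mathcal F^{(1)}\otimes\mathcal F^{(2)}$, $\mathcal F^{-1}=\mathcal F^{-1(1)}\otimes\mathcal F^{-1(2)}$, put $$A^i=\rho(\mathcal F^{(1)})^i_l\,\sigma(\mathcal F^{(2)})\,\mathsf a^l,\qquad A^+_i=\mathsf a^+_l\,\sigma(\mathcal F^{-1(2)})\,\rho(\mathcal F^{-1(1)})^l_i .$$ Let $U,V$ be numerical matrices, i.e. with entries in $\mathbb C[[h]]$, that commute with $\rho^{\otimes2}(\Delta(U\mathfrak g))$, let $F=\rho^{\otimes2}(\mathcal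 F)$, $P^F=FUF^{-1}$, $\tilde P^F=FVF^{-1}$, and let $M=(\rho\otimes\rho\otimes\sigma)(\phi_m)$, a matrix with entries in $\mathcal A_\pm[[h]]$ that depends on $\mathcal F$ only through its coassociator. **Claim.** In $\mathcal A_\pm[[h]]$, each of the following deformed commutation relations (for all $i,j$) is equivalent to the one to its right (for all $i,j$); hence the three relations on the left together are equivalent to the three on the right together: $$\begin{aligned} A^iA^j&=\pm (P^F)^{ji}_{hk}A^kA^h &&\Longleftrightarrow& \mathsf a^i\mathsf a^j&=\pm(M^{-1}UM)^{ji}_{lm}\,\mathsf a^m\mathsf a^l,\\ A^+_iA^+_j&=\pm (P^F)_{ij}^{hk}A^+_hA^+_k &&\Longleftrightarrow& \mathsf a^+_i\mathsf a^+_j&=\pm\,\mathsf a^+_l\mathsf a^+_m(M^{-1}UM)^{lm}_{ij},\\ A^iA^+_j&=\delta^i_j\mathbf 1\pm (\tilde P^F)^{ih}_{jk}A^+_hA^k &&\Longleftrightarrow& \mathsf a^i\mathsf a^+_j&=\delta^i_j\mathbf 1\pm\mathsf a^+_l(M^{-1}VM)^{il}_{jm}\,\mathsf a^m . \end{aligned}$$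 -/

import Mathlib

open scoped TensorProduct BigOperators Topology
open Filter

/- The commutator bracket of an associative ring, as in Mathlib's files on Lie algebras. -/
attribute [local instance 100] LieRing.ofAssociativeRing

noncomputable section

namespace QHeis

/-! ### Power series in the deformation parameter `h`

For a `ℂ`-algebra `B`, `PowerSeries B` is `B[[h]]` (with `h = PowerSeries.X`).  The `h`-adically
completed tensor product of `B[[h]]` and `C[[h]]` over `ℂ[[h]]` is `(B ⊗ C)[[h]]`. -/

/-- The `h`-linear extension of a linear map to power series in `h`. -/
def mapCoeff {V W : Type*} [Ring V] [Algebra ℂ V] [Ring W] [Algebra ℂ W] (f : V →ₗ[ℂ] W)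
    (p : PowerSeries V) : PowerSeries W :=
  PowerSeries.mk fun n => f (PowerSeries.coeff n p)

/-- A numerical series in `ℂ[[h]]`, seen in `B[[h]]`. -/
def scal {B : Type*} [Ring B] [Algebra ℂ B] (c : PowerSeries ℂ) : PowerSeries B :=
  PowerSeries.map (algebraMap ℂ B) c

/-! ### The Hopf algebra structure of the universal enveloping algebra -/

section Enveloping

variable {g : Type*} [LieRing g] [LieAlgebra ℂ g]

variable (g) in
/-- `U𝐠`. -/
abbrev Ug : Type _ := UniversalEnvelopingAlgebra ℂ g

variable (g) in
/-- `U𝐠 ⊗ U𝐠`. -/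
abbrev Ug2 : Type _ := Ug g ⊗[ℂ] Ug g

variable (g) in
/-- `U𝐠 ⊗ U𝐠 ⊗ U𝐠`. -/
abbrev Ug3 : Type _ := Ug g ⊗[ℂ] (Ug g ⊗[ℂ] Ug g)

/-- The inclusion of `𝐠` in `U𝐠`. -/
def inc (x : g) : Ug g := UniversalEnvelopingAlgebra.ι ℂ x

lemma inc_lie (x y : g) : inc ⁅x, y⁆ = inc x * inc y - inc y * inc x := by
  unfold inc
  rw [LieHom.map_lie, LieRing.of_associative_ring_bracket]

/-- `x ↦ x ⊗ 1 + 1 ⊗ x` on `𝐠`. -/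
def primitive : g →ₗ⁅ℂ⁆ Ug2 g where
  toFun x := inc x ⊗ₜ[ℂ] 1 + 1 ⊗ₜ[ℂ] inc x
  map_add' x y := by
    simp only [inc, map_add, TensorProduct.add_tmul, TensorProduct.tmul_add]
    abel
  map_smul' c x := by
    simp only [inc, map_smul, TensorProduct.smul_tmul', TensorProduct.tmul_smul, smul_add,
      RingHom.id_apply]
  map_lie' {x y} := by
    simp only [inc_lie, LieRing.of_associative_ring_bracket, mul_add, add_mul,
      Algebra.TensorProduct.tmul_mul_tmul, one_mul, mul_one, TensorProduct.sub_tmul,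
      TensorProduct.tmul_sub]
    abel

variable (g) in
/-- The (cocommutative) coproduct `Δ` of `U𝐠`. -/
def comul : Ug g →ₐ[ℂ] Ug2 g := UniversalEnvelopingAlgebra.lift ℂ primitive

variable (g) in
/-- The counit `ε` of `U𝐠`. -/
def counit : Ug g →ₐ[ℂ] ℂ := UniversalEnvelopingAlgebra.lift ℂ (0 : g →ₗ⁅ℂ⁆ ℂ)

variable (g) in
/-- `a ⊗ b ↦ a ⊗ b ⊗ 1`. -/
def leg12 : Ug2 g →ₐ[ℂ] Ug3 g :=
  Algebra.TensorProduct.map (AlgHom.id ℂ (Ug g)) Algebra.TensorProduct.includeLeft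

variable (g) in
/-- `a ⊗ b ↦ 1 ⊗ a ⊗ b`. -/
def leg23 : Ug2 g →ₐ[ℂ] Ug3 g := Algebra.TensorProduct.includeRight

variable (g) in
/-- `Δ ⊗ id`. -/
def comulId : Ug2 g →ₐ[ℂ] Ug3 g :=
  (Algebra.TensorProduct.assoc ℂ ℂ ℂ (Ug g) (Ug g) (Ug g)).toAlgHom.comp
    (Algebra.TensorProduct.map (comul g) (AlgHom.id ℂ (Ug g)))

variable (g) in
/-- `id ⊗ Δ`. -/
def idComul : Ug2 g →ₐ[ℂ] Ug3 g :=
  Algebra.TensorProduct.map (AlgHom.id ℂ (Ug g)) (comul g)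

/-! ### Twists and their coassociators -/

/-- A twist is an element `F` of `U𝐠[[h]] ⊗ U𝐠[[h]]` with
`(ε ⊗ id) F = 1 = (id ⊗ ε) F` and `F = 1 ⊗ 1 + O(h)`. -/
structure IsTwist (F : PowerSeries (Ug2 g)) : Prop where
  counit_left : mapCoeff ((TensorProduct.lid ℂ (Ug g)).toLinearMap ∘ₗ
    TensorProduct.map (counit g).toLinearMap LinearMap.id) F = 1
  counit_right : mapCoeff ((TensorProduct.rid ℂ (Ug g)).toLinearMap ∘ₗ
    TensorProduct.map LinearMap.id (counit g).toLinearMap) F = 1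
  const : PowerSeries.constantCoeff F = 1

/-- The coassociator `φ = [(Δ ⊗ id) F⁻¹] (F⁻¹ ⊗ 1) (1 ⊗ F) [(id ⊗ Δ) F]` of `F`. -/
def coassociator (F : PowerSeries (Ug2 g)) : PowerSeries (Ug3 g) :=
  PowerSeries.map (comulId g).toRingHom (Ring.inverse F) *
    PowerSeries.map (leg12 g).toRingHom (Ring.inverse F) *
    PowerSeries.map (leg23 g).toRingHom F *
    PowerSeries.map (idComul g).toRingHom F

/-! ### The quadratic Casimir and the invariant element `t` -/

/-- The quadratic Casimir `C = ∑ e_i e^i` of a non-degenerate form `B` (the bases `e_i`, `e^i`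
being `B`-dual to each other; `C` does not depend on the basis). -/
def casimir [FiniteDimensional ℂ g] (B : LinearMap.BilinForm ℂ g) (hB : B.Nondegenerate) : Ug g :=
  ∑ i, inc (Module.finBasis ℂ g i) * inc (B.dualBasis hB (Module.finBasis ℂ g) i)

/-- `t = Δ(C) - 1 ⊗ C - C ⊗ 1`. -/
def canonicalT [FiniteDimensional ℂ g] (B : LinearMap.BilinForm ℂ g) (hB : B.Nondegenerate) :
    Ug2 g :=
  comul g (casimir B hB) - 1 ⊗ₜ[ℂ] casimir B hB - casimir B hB ⊗ₜ[ℂ] 1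

/-! ### The Knizhnik-Zamolodchikov coassociator -/

/-- The number `1 / (2πi)`; thus `ħ = h / (2πi)`. -/
def hbarFactor : ℂ := (2 * (Real.pi : ℂ) * Complex.I)⁻¹

/-- `y ^ (ħ w) = exp (ħ (log y) w)` for `y > 0`, as a power series in `h`. -/
def hbarPow (y : ℝ) (w : Ug3 g) : PowerSeries (Ug3 g) :=
  PowerSeries.mk fun n =>
    ((hbarFactor * (Real.log y : ℂ)) ^ n / (n.factorial : ℂ)) • w ^ n

/-- The coefficient `ħ (t₁₂ / x + t₂₃ / (x - 1))` of the differential equation. -/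
def kzField (t : Ug2 g) (x : ℝ) : PowerSeries (Ug3 g) :=
  PowerSeries.X * PowerSeries.C
    (hbarFactor • ((x : ℂ)⁻¹ • leg12 g t + ((x : ℂ) - 1)⁻¹ • leg23 g t))

/-- `G` is an analytic solution on `0 < x < 1` of `dG/dx = ħ (t₁₂ / x + t₂₃ / (x - 1)) G`:
each coefficient of `h ^ n` takes values in a finite-dimensional subspace of `U𝐠 ⊗ U𝐠 ⊗ U𝐠`.
Analyticity and derivatives of such a function are tested by linear functionals, which is
the same as using the topology of that finite-dimensional subspace. -/
structure IsKZSolution (t : Ug2 g) (G : ℝ → PowerSeries (Ug3 g)) : Prop where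
  finite : ∀ n : ℕ, ∃ W : Submodule ℂ (Ug3 g), FiniteDimensional ℂ W ∧
    ∀ x ∈ Set.Ioo (0 : ℝ) 1, PowerSeries.coeff n (G x) ∈ W
  analytic : ∀ (n : ℕ) (l : Ug3 g →ₗ[ℂ] ℂ),
    AnalyticOnNhd ℝ (fun x => l (PowerSeries.coeff n (G x))) (Set.Ioo (0 : ℝ) 1)
  deriv : ∀ x ∈ Set.Ioo (0 : ℝ) 1, ∀ (n : ℕ) (l : Ug3 g →ₗ[ℂ] ℂ),
    HasDerivAt (fun y : ℝ => l (PowerSeries.coeff n (G y)))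
      (l (PowerSeries.coeff n (kzField t x * G x))) x

/-- Convergence to `1 ⊗ 1 ⊗ 1`, coefficientwise in `h`. -/
def TendsToOne (G : ℝ → PowerSeries (Ug3 g)) (f : Filter ℝ) : Prop :=
  ∀ (n : ℕ) (l : Ug3 g →ₗ[ℂ] ℂ), Tendsto (fun x => l (PowerSeries.coeff n (G x))) f
    (𝓝 (l (PowerSeries.coeff n (1 : PowerSeries (Ug3 g)))))

/-- `φ = ĝ(x)⁻¹ ǧ(x)` for `0 < x < 1`, where `ĝ`, `ǧ` are the solutions of the differential
equation with `ĝ(x) x ^ (-ħ t₁₂) → 1` for `x → 0` and `ǧ(x) (1 - x) ^ (-ħ t₂₃) → 1` for `x → 1`. -/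
def IsKZCoassociator (t : Ug2 g) (φ : PowerSeries (Ug3 g)) : Prop :=
  ∃ gHat gCheck : ℝ → PowerSeries (Ug3 g),
    IsKZSolution t gHat ∧ IsKZSolution t gCheck ∧
    TendsToOne (fun x => gHat x * hbarPow x (-leg12 g t)) (𝓝[>] 0) ∧
    TendsToOne (fun x => gCheck x * hbarPow (1 - x) (-leg23 g t)) (𝓝[<] 1) ∧
    ∀ x ∈ Set.Ioo (0 : ℝ) 1, φ = Ring.inverse (gHat x) * gCheck x

variable (g) in
/-- The coassociators `φ_m` of minimal twists.  In the genuinely quasitriangular case `𝐠` is a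
simple finite-dimensional Lie algebra and `φ_m` is the Knizhnik-Zamolodchikov coassociator of the
element `t` of its quadratic Casimir (normalized by an invariant form); in the triangular case
`φ_m` is trivial. -/
inductive IsMinimalCoassociator : PowerSeries (Ug3 g) → Prop
  | quasitriangular [FiniteDimensional ℂ g] [LieAlgebra.IsSimple ℂ g]
      (B : LinearMap.BilinForm ℂ g) (hB : B.Nondegenerate) (hsymm : B.IsSymm)
      (hinv : B.lieInvariant g) (φ : PowerSeries (Ug3 g))
      (hφ : IsKZCoassociator (canonicalT B hB) φ) : IsMinimalCoassociator φ
  | triangular : IsMinimalCoassociator 1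

end Enveloping

/-! ### The Weyl and Clifford algebras -/

section Heisenberg

variable {ι : Type*} [DecidableEq ι]

/-- The relations of the Weyl (`s = 1`) and of the Clifford (`s = -1`) algebra; `Sum.inl i` stands
for `a^i` and `Sum.inr i` for `a⁺_i`. -/
inductive HeisRel (s : ℤˣ) : FreeAlgebra ℂ (ι ⊕ ι) → FreeAlgebra ℂ (ι ⊕ ι) → Prop
  | lower (i j : ι) : HeisRel s
      (FreeAlgebra.ι ℂ (Sum.inl i) * FreeAlgebra.ι ℂ (Sum.inl j))
      ((s : ℤ) • (FreeAlgebra.ι ℂ (Sum.inl j) * FreeAlgebra.ι ℂ (Sum.inl i)))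
  | raise (i j : ι) : HeisRel s
      (FreeAlgebra.ι ℂ (Sum.inr i) * FreeAlgebra.ι ℂ (Sum.inr j))
      ((s : ℤ) • (FreeAlgebra.ι ℂ (Sum.inr j) * FreeAlgebra.ι ℂ (Sum.inr i)))
  | mixed (i j : ι) : HeisRel s
      (FreeAlgebra.ι ℂ (Sum.inl i) * FreeAlgebra.ι ℂ (Sum.inr j))
      ((if i = j then 1 else 0) +
        (s : ℤ) • (FreeAlgebra.ι ℂ (Sum.inr j) * FreeAlgebra.ι ℂ (Sum.inl i)))

variable (ι) in
/-- The Heisenberg algebra `𝓐_±` with generators `a^i`, `a⁺_i`, `i ∈ ι`. -/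
def Heis (s : ℤˣ) : Type _ := RingQuot (HeisRel (ι := ι) s)

instance (s : ℤˣ) : Ring (Heis ι s) := inferInstanceAs (Ring (RingQuot (HeisRel (ι := ι) s)))

instance (s : ℤˣ) : Algebra ℂ (Heis ι s) :=
  inferInstanceAs (Algebra ℂ (RingQuot (HeisRel (ι := ι) s)))

variable (ι) in
/-- The quotient map from the free algebra. -/
def Heis.mk (s : ℤˣ) : FreeAlgebra ℂ (ι ⊕ ι) →ₐ[ℂ] Heis ι s := RingQuot.mkAlgHom ℂ (HeisRel s)

lemma Heis.mk_rel {s : ℤˣ} {x y : FreeAlgebra ℂ (ι ⊕ ι)} (h : HeisRel s x y) :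
    Heis.mk ι s x = Heis.mk ι s y := RingQuot.mkAlgHom_rel ℂ h

/-- The generator `a^i`. -/
def aLow (s : ℤˣ) (i : ι) : Heis ι s := Heis.mk ι s (FreeAlgebra.ι ℂ (Sum.inl i))

/-- The generator `a⁺_i`. -/
def aUp (s : ℤˣ) (i : ι) : Heis ι s := Heis.mk ι s (FreeAlgebra.ι ℂ (Sum.inr i))

lemma aLow_mul_aLow (s : ℤˣ) (i j : ι) :
    aLow s i * aLow s j = (s : ℤ) • (aLow s j * aLow s i) := by
  have h := Heis.mk_rel (HeisRel.lower (s := s) i j)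
  rw [map_mul, map_zsmul, map_mul] at h
  exact h

lemma aUp_mul_aUp (s : ℤˣ) (i j : ι) :
    aUp s i * aUp s j = (s : ℤ) • (aUp s j * aUp s i) := by
  have h := Heis.mk_rel (HeisRel.raise (s := s) i j)
  rw [map_mul, map_zsmul, map_mul] at h
  exact h

lemma aLow_mul_aUp (s : ℤˣ) (i j : ι) :
    aLow s i * aUp s j = (if i = j then 1 else 0) + (s : ℤ) • (aUp s j * aLow s i) := by
  have h := Heis.mk_rel (HeisRel.mixed (s := s) i j)
  rw [map_mul, map_add, map_zsmul, map_mul, apply_ite (Heis.mk ι s), map_one,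
    map_zero] at h
  exact h

lemma sign_mul_self (s : ℤˣ) : (s : ℤ) * (s : ℤ) = 1 := by
  rcases Int.units_eq_one_or s with rfl | rfl <;> simp

lemma pair_mul_pair (s : ℤˣ) (i j k l : ι) :
    (aUp s i * aLow s j) * (aUp s k * aLow s l) =
      (if j = k then aUp s i * aLow s l else 0) +
        (s : ℤ) • (aUp s i * aUp s k * (aLow s j * aLow s l)) := by
  have h : (aUp s i * aLow s j) * (aUp s k * aLow s l) =
      aUp s i * (aLow s j * aUp s k) * aLow s l := by simp only [mul_assoc]
  rw [h, aLow_mul_aUp, mul_add, add_mul, mul_smul_comm, smul_mul_assoc]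
  congr 1
  · split_ifs <;> simp
  · simp only [mul_assoc]

lemma pair_commutator (s : ℤˣ) (i j k l : ι) :
    (aUp s i * aLow s j) * (aUp s k * aLow s l) - (aUp s k * aLow s l) * (aUp s i * aLow s j) =
      (if j = k then aUp s i * aLow s l else 0) - (if l = i then aUp s k * aLow s j else 0) := by
  rw [pair_mul_pair, pair_mul_pair, aUp_mul_aUp s i k, aLow_mul_aLow s j l, smul_mul_smul_comm,
    sign_mul_self, one_smul]
  abel

lemma pair_aUp (s : ℤˣ) (i j k : ι) :
    aUp s i * aLow s j * aUp s k - aUp s k * (aUp s i * aLow s j) =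
      if j = k then aUp s i else 0 := by
  rw [mul_assoc, aLow_mul_aUp, mul_add, mul_smul_comm, ← mul_assoc, ← mul_assoc,
    aUp_mul_aUp s i k, smul_mul_assoc, smul_smul, sign_mul_self, one_smul]
  split_ifs <;> simp

lemma pair_aLow (s : ℤˣ) (i j k : ι) :
    aUp s i * aLow s j * aLow s k - aLow s k * (aUp s i * aLow s j) =
      if k = i then -aLow s j else 0 := by
  rw [← mul_assoc, aLow_mul_aUp, add_mul, smul_mul_assoc, mul_assoc, mul_assoc,
    aLow_mul_aLow s k j, mul_smul_comm, smul_smul, sign_mul_self, one_smul]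
  split_ifs <;> simp

variable [Fintype ι] {g : Type*} [LieRing g] [LieAlgebra ℂ g]

/-- The Jordan-Schwinger realization `σ(x) = ρ(x)^i_j a⁺_i a^j` on `𝐠`. -/
def jordanSchwinger (s : ℤˣ) (ρ : g →ₗ⁅ℂ⁆ Matrix ι ι ℂ) : g →ₗ⁅ℂ⁆ Heis ι s where
  toFun x := ∑ i, ∑ j, ρ x i j • (aUp s i * aLow s j)
  map_add' x y := by
    simp only [map_add, Matrix.add_apply, add_smul, Finset.sum_add_distrib]
  map_smul' c x := by
    simp only [map_smul, Matrix.smul_apply, smul_eq_mul, mul_smul, Finset.smul_sum,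
      RingHom.id_apply]
  map_lie' {x y} := by
    have key : ∀ M N : Matrix ι ι ℂ,
        (∑ i, ∑ j, M i j • (aUp s i * aLow s j)) * (∑ k, ∑ l, N k l • (aUp s k * aLow s l)) -
        (∑ k, ∑ l, N k l • (aUp s k * aLow s l)) * (∑ i, ∑ j, M i j • (aUp s i * aLow s j)) =
        (∑ i, ∑ l, (M * N) i l • (aUp s i * aLow s l)) -
          ∑ k, ∑ j, (N * M) k j • (aUp s k * aLow s j) := by
      intro M N
      have e1 : (∑ i, ∑ j, M i j • (aUp s i * aLow s j)) *
          (∑ k, ∑ l, N k l • (aUp s k * aLow s l)) =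
          ∑ i, ∑ j, ∑ k, ∑ l, (M i j * N k l) •
            ((aUp s i * aLow s j) * (aUp s k * aLow s l)) := by
        rw [Finset.sum_mul_sum]
        refine Finset.sum_congr rfl fun i _ => ?_
        rw [Finset.sum_comm (s := (Finset.univ : Finset ι)) (t := Finset.univ)
          (f := fun j k => ∑ l, (M i j * N k l) • ((aUp s i * aLow s j) * (aUp s k * aLow s l)))]
        refine Finset.sum_congr rfl fun k _ => ?_
        rw [Finset.sum_mul_sum]
        simp only [smul_mul_smul_comm]
      have e2 : (∑ k, ∑ l, N k l • (aUp s k * aLow s l)) *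
          (∑ i, ∑ j, M i j • (aUp s i * aLow s j)) =
          ∑ i, ∑ j, ∑ k, ∑ l, (M i j * N k l) •
            ((aUp s k * aLow s l) * (aUp s i * aLow s j)) := by
        rw [Finset.sum_mul_sum, Finset.sum_comm]
        refine Finset.sum_congr rfl fun i _ => ?_
        rw [Finset.sum_comm (s := (Finset.univ : Finset ι)) (t := Finset.univ)
          (f := fun j k => ∑ l, (M i j * N k l) • ((aUp s k * aLow s l) * (aUp s i * aLow s j)))]
        refine Finset.sum_congr rfl fun k _ => ?_
        rw [Finset.sum_mul_sum, Finset.sum_comm]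
        simp only [smul_mul_smul_comm, mul_comm (N k _)]
      rw [e1, e2]
      simp only [← Finset.sum_sub_distrib, ← smul_sub, pair_commutator]
      simp only [smul_sub, Finset.sum_sub_distrib, smul_ite, smul_zero]
      congr 1
      · refine Finset.sum_congr rfl fun i _ => ?_
        simp only [Matrix.mul_apply, Finset.sum_smul]
        rw [Finset.sum_comm (s := (Finset.univ : Finset ι)) (t := Finset.univ)
          (f := fun l j => (M i j * N j l) • (aUp s i * aLow s l))]
        refine Finset.sum_congr rfl fun j _ => ?_
        rw [Finset.sum_comm]
        refine Finset.sum_congr rfl fun l _ => ?_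
        simp
      · simp only [Matrix.mul_apply, Finset.sum_smul]
        rw [Finset.sum_comm]
        rw [Finset.sum_comm (s := (Finset.univ : Finset ι)) (t := Finset.univ)
          (f := fun k j => ∑ i, (N k i * M i j) • (aUp s k * aLow s j))]
        refine Finset.sum_congr rfl fun j _ => ?_
        rw [Finset.sum_comm]
        refine Finset.sum_congr rfl fun k _ => ?_
        refine Finset.sum_congr rfl fun i _ => ?_
        simp [mul_comm]
    simp only [LieHom.map_lie, LieRing.of_associative_ring_bracket, key, Matrix.sub_apply, sub_smul,
      Finset.sum_sub_distrib]

/-- `σ : U𝐠 → 𝓐_±`. -/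
def sigma (s : ℤˣ) (ρ : g →ₗ⁅ℂ⁆ Matrix ι ι ℂ) : Ug g →ₐ[ℂ] Heis ι s :=
  UniversalEnvelopingAlgebra.lift ℂ (jordanSchwinger s ρ)

/-- The extension of a matrix representation `ρ` of `𝐠` to `U𝐠`. -/
def rep (ρ : g →ₗ⁅ℂ⁆ Matrix ι ι ℂ) : Ug g →ₐ[ℂ] Matrix ι ι ℂ :=
  UniversalEnvelopingAlgebra.lift ℂ ρ

/-- The linear functional `x ↦ ρ(x)^i_j` on `U𝐠`. -/
def repEntry (ρ : g →ₗ⁅ℂ⁆ Matrix ι ι ℂ) (i j : ι) : Ug g →ₗ[ℂ] ℂ :=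
  Matrix.entryLinearMap ℂ ℂ i j ∘ₗ (rep ρ).toLinearMap

/-- The action `▷` of `U𝐠` on `𝓐_±`: an element `x` of `𝐠` acts as the derivation with
`x ▷ a⁺_i = ρ(x)^j_i a⁺_j` and `x ▷ a^i = -ρ(x)^i_j a^j`, which is the commutator with `σ(x)`
(see `act_aUp`, `act_aLow`, `act_mul` below). -/
def act (s : ℤˣ) (ρ : g →ₗ⁅ℂ⁆ Matrix ι ι ℂ) : Ug g →ₐ[ℂ] Module.End ℂ (Heis ι s) :=
  UniversalEnvelopingAlgebra.lift ℂ
    ((LieAlgebra.ad ℂ (Heis ι s)).comp (jordanSchwinger s ρ))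

lemma act_inc (s : ℤˣ) (ρ : g →ₗ⁅ℂ⁆ Matrix ι ι ℂ) (x : g) (b : Heis ι s) :
    act s ρ (inc x) b = jordanSchwinger s ρ x * b - b * jordanSchwinger s ρ x := by
  simp only [act, inc, UniversalEnvelopingAlgebra.lift_ι_apply, LieHom.comp_apply,
    LieAlgebra.ad_apply, LieRing.of_associative_ring_bracket]

lemma act_mul (s : ℤˣ) (ρ : g →ₗ⁅ℂ⁆ Matrix ι ι ℂ) (x : g) (b c : Heis ι s) :
    act s ρ (inc x) (b * c) = act s ρ (inc x) b * c + b * act s ρ (inc x) c := by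
  simp only [act_inc, sub_mul, mul_sub, mul_assoc]
  abel

lemma act_aUp (s : ℤˣ) (ρ : g →ₗ⁅ℂ⁆ Matrix ι ι ℂ) (x : g) (i : ι) :
    act s ρ (inc x) (aUp s i) = ∑ j, ρ x j i • aUp s j := by
  rw [act_inc]
  change (∑ k, ∑ j, ρ x k j • (aUp s k * aLow s j)) * aUp s i -
    aUp s i * (∑ k, ∑ j, ρ x k j • (aUp s k * aLow s j)) = _
  simp only [Finset.sum_mul, Finset.mul_sum, smul_mul_assoc, mul_smul_comm,
    ← Finset.sum_sub_distrib, ← smul_sub, pair_aUp, smul_ite, smul_zero, Finset.sum_ite_eq',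
    Finset.mem_univ, if_true]

lemma act_aLow (s : ℤˣ) (ρ : g →ₗ⁅ℂ⁆ Matrix ι ι ℂ) (x : g) (i : ι) :
    act s ρ (inc x) (aLow s i) = -∑ j, ρ x i j • aLow s j := by
  rw [act_inc]
  change (∑ k, ∑ j, ρ x k j • (aUp s k * aLow s j)) * aLow s i -
    aLow s i * (∑ k, ∑ j, ρ x k j • (aUp s k * aLow s j)) = _
  simp only [Finset.sum_mul, Finset.mul_sum, smul_mul_assoc, mul_smul_comm,
    ← Finset.sum_sub_distrib, ← smul_sub, pair_aLow, smul_ite, smul_zero]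
  rw [Finset.sum_comm]
  simp

/-- `I ∈ 𝓐_±[[h]]` is `𝐠`-invariant: `x ▷ I = ε(x) I` for all `x ∈ U𝐠`. -/
def IsInvariant (s : ℤˣ) (ρ : g →ₗ⁅ℂ⁆ Matrix ι ι ℂ) (I : PowerSeries (Heis ι s)) : Prop :=
  ∀ x : Ug g, mapCoeff (act s ρ x) I = counit g x • I

/-- `I` is a `𝐠`-invariant of the form `1 + O(h)`. -/
def IsDressing (s : ℤˣ) (ρ : g →ₗ⁅ℂ⁆ Matrix ι ι ℂ) (I : PowerSeries (Heis ι s)) : Prop :=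
  IsInvariant s ρ I ∧ PowerSeries.constantCoeff I = 1

/-! ### Matrices obtained from universal elements -/

/-- The matrix `ρ^{⊗2}(w)` for `w ∈ U𝐠 ⊗ U𝐠`. -/
def rhoRho (ρ : g →ₗ⁅ℂ⁆ Matrix ι ι ℂ) (w : Ug2 g) : Matrix (ι × ι) (ι × ι) ℂ :=
  Matrix.of fun p q => TensorProduct.lid ℂ ℂ
    (TensorProduct.map (repEntry ρ p.1 q.1) (repEntry ρ p.2 q.2) w)

/-- The numerical matrix `F = ρ^{⊗2}(𝓕)`. -/
def rhoRhoSeries (ρ : g →ₗ⁅ℂ⁆ Matrix ι ι ℂ) (F : PowerSeries (Ug2 g)) :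
    Matrix (ι × ι) (ι × ι) (PowerSeries ℂ) :=
  Matrix.of fun p q => PowerSeries.mk fun n => rhoRho ρ (PowerSeries.coeff n F) p q

/-- The matrix `(ρ ⊗ σ)(F)`, with entries `ρ(F^{(1)})^i_l σ(F^{(2)})` in `𝓐_±[[h]]`. -/
def rhoSigma (s : ℤˣ) (ρ : g →ₗ⁅ℂ⁆ Matrix ι ι ℂ) (F : PowerSeries (Ug2 g)) :
    Matrix ι ι (PowerSeries (Heis ι s)) :=
  Matrix.of fun i l => mapCoeff ((TensorProduct.lid ℂ (Heis ι s)).toLinearMap ∘ₗ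
    TensorProduct.map (repEntry ρ i l) (sigma s ρ).toLinearMap) F

/-- The matrix `(ρ ⊗ ρ ⊗ σ)(φ)`, with entries `ρ(φ^{(1)})^i_h ρ(φ^{(2)})^j_k σ(φ^{(3)})` in
`𝓐_±[[h]]`. -/
def rhoRhoSigma (s : ℤˣ) (ρ : g →ₗ⁅ℂ⁆ Matrix ι ι ℂ) (φ : PowerSeries (Ug3 g)) :
    Matrix (ι × ι) (ι × ι) (PowerSeries (Heis ι s)) :=
  Matrix.of fun p q => mapCoeff ((TensorProduct.lid ℂ (Heis ι s)).toLinearMap ∘ₗ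
    TensorProduct.map (repEntry ρ p.1 q.1) ((TensorProduct.lid ℂ (Heis ι s)).toLinearMap ∘ₗ
      TensorProduct.map (repEntry ρ p.2 q.2) (sigma s ρ).toLinearMap)) φ

/-- `[U, ρ^{⊗2}(Δ(U𝐠))] = 0`. -/
def CommutesWithCoproduct (ρ : g →ₗ⁅ℂ⁆ Matrix ι ι ℂ)
    (U : Matrix (ι × ι) (ι × ι) (PowerSeries ℂ)) : Prop :=
  ∀ x : Ug g, Commute U ((rhoRho ρ (comul g x)).map PowerSeries.C)

/-- `F U F⁻¹` with `F = ρ^{⊗2}(𝓕)`: the deformed permutators `P^F` (for `U`) and `P̃^F` (for `V`).-/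
def twistedMatrix (ρ : g →ₗ⁅ℂ⁆ Matrix ι ι ℂ) (F : PowerSeries (Ug2 g))
    (U : Matrix (ι × ι) (ι × ι) (PowerSeries ℂ)) : Matrix (ι × ι) (ι × ι) (PowerSeries ℂ) :=
  rhoRhoSeries ρ F * U * (rhoRhoSeries ρ F)⁻¹

/-- `M⁻¹ U M` for a matrix `M` over `𝓐_±[[h]]` and a numerical matrix `U`. -/
def dressedMatrix {s : ℤˣ} (M : Matrix (ι × ι) (ι × ι) (PowerSeries (Heis ι s)))
    (U : Matrix (ι × ι) (ι × ι) (PowerSeries ℂ)) :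
    Matrix (ι × ι) (ι × ι) (PowerSeries (Heis ι s)) :=
  Ring.inverse M * U.map scal * M

/-! ### Dressed and deformed generators -/

/-- `𝖺^i = u a^i û`, with one pair `(u, û)` for each block of `ρ`; `c i` is the block of `i`. -/
def dressedLow {κ : Type*} (s : ℤˣ) (c : ι → κ) (u uHat : κ → PowerSeries (Heis ι s)) (i : ι) :
    PowerSeries (Heis ι s) :=
  u (c i) * PowerSeries.C (aLow s i) * uHat (c i)

/-- `𝖺⁺_i = v a⁺_i v̂`, with one pair `(v, v̂)` for each block of `ρ`. -/
def dressedUp {κ : Type*} (s : ℤˣ) (c : ι → κ) (v vHat : κ → PowerSeries (Heis ι s)) (i : ι) :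
    PowerSeries (Heis ι s) :=
  v (c i) * PowerSeries.C (aUp s i) * vHat (c i)

/-- `A^i = ρ(F^{(1)})^i_l σ(F^{(2)}) 𝖺^l`. -/
def deformedLow (s : ℤˣ) (ρ : g →ₗ⁅ℂ⁆ Matrix ι ι ℂ) (F : PowerSeries (Ug2 g))
    (a : ι → PowerSeries (Heis ι s)) (i : ι) : PowerSeries (Heis ι s) :=
  ∑ l, rhoSigma s ρ F i l * a l

/-- `A⁺_i = 𝖺⁺_l σ(F^{-1(2)}) ρ(F^{-1(1)})^l_i`. -/
def deformedUp (s : ℤˣ) (ρ : g →ₗ⁅ℂ⁆ Matrix ι ι ℂ) (F : PowerSeries (Ug2 g))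
    (aPlus : ι → PowerSeries (Heis ι s)) (i : ι) : PowerSeries (Heis ι s) :=
  ∑ l, aPlus l * rhoSigma s ρ (Ring.inverse F) l i

end Heisenberg

end QHeis

end

/-!
Quadratic relations between the deformed generators `A` become relations between the dressed
generators `𝖺` when their matrix is conjugated with an invertible matrix `Q` built from the twist.
The conjugate of `F U F⁻¹` depends on the twist only through its coassociator, because `U` commutes
with `ρ^{⊗2}(Δ(U𝐠))`.

The dressed generators still transform like `a^i` and `a⁺_i` under the adjoint action, because the
dressing factors commute with `σ(U𝐠)` and `ρ(x)` does not mix blocks.  For `x ∈ 𝐠` this says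
`𝖺^i σ(x) = σ(x) 𝖺^i + ρ(x)^i_k 𝖺^k`, and multiplicativity turns it into
`𝖺^i σ(y) = (ρ ⊗ σ)(Δ y)^i_k 𝖺^k` for all `y ∈ U𝐠` (`IsLowerTensor.mul_sigma`, and
`IsUpperTensor.sigma_mul` for the `𝖺⁺_i`).  Hence in a product such as
`A^j A^i = (ρ ⊗ σ)(F)^j_l 𝖺^l (ρ ⊗ σ)(F)^i_k 𝖺^k` the second matrix can be moved to the left of
`𝖺^l`, where it becomes `(ρ ⊗ ρ ⊗ σ)((id ⊗ Δ) F)`.  With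
`Q = (ρ ⊗ ρ ⊗ σ)((1 ⊗ F) (id ⊗ Δ)(F))` (`towerMatrix`) this gives
* `A^j A^i = Q^{ij}_{km} 𝖺^m 𝖺^k` (`colBlock_mulVec_deformedLow`),
* `A⁺_i A⁺_j = 𝖺⁺_l 𝖺⁺_m (Q⁻¹)^{lm}_{ij}` (`vecMul_rowBlock_deformedUp`),
* `N⁻¹ (A⁺_h P^{ih}_{jk} A^k) N = 𝖺⁺_l (Q⁻¹ P Q)^{il}_{jm} 𝖺^m` with `N = (ρ ⊗ σ)(F)`
  (`rowBlock_mul_colBlock_deformed`).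

All the relations are therefore equivalent to relations for `𝖺` with the matrix
`Q⁻¹ F U F⁻¹ Q`.  By definition of the coassociator `M = D⁻¹ F⁻¹ Q` with
`D = (ρ ⊗ ρ ⊗ σ)((Δ ⊗ id) F)`, and `U` commutes with `D`, so that this matrix is `M⁻¹ U M`
(`dressedMatrix_coassociator`).

Index bookkeeping is done with the rectangular matrices `1 ⊗ 𝖺` (`colBlock`, `rowBlock`), so that
every step is an identity between products of matrices over `𝓐_±[[h]]`.
-/

noncomputable section

namespace QHeis

/-! ### Matrix representations over power series -/

section Coefficients

variable {C n : Type*} [Ring C]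

lemma matrix_series_ext {X Y : Matrix n n (PowerSeries C)}
    (h : ∀ N, X.map (PowerSeries.coeff N) = Y.map (PowerSeries.coeff N)) : X = Y := by
  ext i j N
  exact congrFun (congrFun (h N) i) j

lemma matrix_map_coeff_mul [Fintype n] (X Y : Matrix n n (PowerSeries C)) (N : ℕ) :
    (X * Y).map (PowerSeries.coeff N) = ∑ p ∈ Finset.HasAntidiagonal.antidiagonal N,
      X.map (PowerSeries.coeff p.1) * Y.map (PowerSeries.coeff p.2) := by
  ext i j
  simp only [Matrix.map_apply, Matrix.mul_apply, map_sum, PowerSeries.coeff_mul,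
    Matrix.sum_apply]
  exact Finset.sum_comm

lemma isUnit_of_constantCoeff_eq_one {p : PowerSeries C} (hp : PowerSeries.constantCoeff p = 1) :
    IsUnit p :=
  PowerSeries.isUnit_iff_constantCoeff.2 (hp ▸ isUnit_one)

end Coefficients

section Series

variable {A B C m n : Type*} [Ring A] [Algebra ℂ A] [Ring B] [Algebra ℂ B] [Ring C] [Algebra ℂ C]
  [Fintype m] [DecidableEq m] [Fintype n] [DecidableEq n]

/-- The `h`-linear extension `B[[h]] → Mat_n(C)[[h]] = Mat_n(C[[h]])` of a matrix representation
of `B` with entries in `C`. -/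
def matSeries (T : B →ₐ[ℂ] Matrix n n C) : PowerSeries B →+* Matrix n n (PowerSeries C) where
  toFun p := Matrix.of fun i j => PowerSeries.mk fun N => T (PowerSeries.coeff N p) i j
  map_one' := by
    refine matrix_series_ext fun N => ?_
    ext i j
    by_cases hN : N = 0 <;> by_cases hij : i = j <;>
      simp [PowerSeries.coeff_one, hN, hij]
  map_mul' p q := by
    refine matrix_series_ext fun N => ?_
    rw [matrix_map_coeff_mul]
    ext i j
    simp [PowerSeries.coeff_mul, Matrix.sum_apply, Matrix.mul_apply]
  map_zero' := by
    ext i j N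
    simp
  map_add' p q := by
    ext i j N
    simp

lemma coeff_matSeries (T : B →ₐ[ℂ] Matrix n n C) (p : PowerSeries B) (i j : n) (N : ℕ) :
    PowerSeries.coeff N (matSeries T p i j) = T (PowerSeries.coeff N p) i j := by
  simp [matSeries]

lemma map_coeff_matSeries (T : B →ₐ[ℂ] Matrix n n C) (p : PowerSeries B) (N : ℕ) :
    (matSeries T p).map (PowerSeries.coeff N) = T (PowerSeries.coeff N p) := by
  ext i j
  exact coeff_matSeries T p i j N

/-- The representation `f ⊗ T` of `A ⊗ B` for a numerical representation `f` of `A` and a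
representation `T` of `B` with entries in `C`; its entries are `f(a)^i_k T(b)^j_l`. -/
def kronHom (f : A →ₐ[ℂ] Matrix m m ℂ) (T : B →ₐ[ℂ] Matrix n n C) :
    A ⊗[ℂ] B →ₐ[ℂ] Matrix (m × n) (m × n) C :=
  Algebra.TensorProduct.algHomOfLinearMapTensorProduct
    (TensorProduct.lift (LinearMap.mk₂ ℂ
      (fun a b => Matrix.of fun p q : m × n => f a p.1 q.1 • T b p.2 q.2)
      (fun a a' b => by ext p q; simp [add_smul])
      (fun c a b => by ext p q; simp [mul_smul])
      (fun a b b' => by ext p q; simp)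
      (fun c a b => by ext p q; simp [smul_comm c])))
    (fun a a' b b' => by
      ext p q
      simp only [TensorProduct.lift.tmul, LinearMap.mk₂_apply, map_mul, Matrix.mul_apply,
        Matrix.of_apply, Fintype.sum_prod_type, Finset.sum_smul_sum, smul_mul_smul_comm])
    (by
      ext p q
      by_cases h₁ : p.1 = q.1 <;> by_cases h₂ : p.2 = q.2 <;>
        simp [Matrix.one_apply, Prod.ext_iff, h₁, h₂])

@[simp]
lemma kronHom_tmul (f : A →ₐ[ℂ] Matrix m m ℂ) (T : B →ₐ[ℂ] Matrix n n C) (a : A) (b : B)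
    (p q : m × n) : kronHom f T (a ⊗ₜ b) p q = f a p.1 q.1 • T b p.2 q.2 := rfl

/-- The representation `f ⊗ τ` of `A ⊗ B` for a numerical representation `f` of `A` and a
homomorphism `τ : B → C`; its entries are `f(a)^i_k τ(b)`. -/
def scalarHom (f : A →ₐ[ℂ] Matrix m m ℂ) (τ : B →ₐ[ℂ] C) : A ⊗[ℂ] B →ₐ[ℂ] Matrix m m C :=
  Algebra.TensorProduct.algHomOfLinearMapTensorProduct
    (TensorProduct.lift (LinearMap.mk₂ ℂ
      (fun a b => Matrix.of fun i j : m => f a i j • τ b)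
      (fun a a' b => by ext p q; simp [add_smul])
      (fun c a b => by ext p q; simp [mul_smul])
      (fun a b b' => by ext p q; simp)
      (fun c a b => by ext p q; simp [smul_comm c])))
    (fun a a' b b' => by
      ext p q
      simp only [TensorProduct.lift.tmul, LinearMap.mk₂_apply, map_mul, Matrix.mul_apply,
        Matrix.of_apply, Finset.sum_smul, smul_mul_smul_comm])
    (by
      ext i j
      by_cases h : i = j <;> simp [Matrix.one_apply, h])

@[simp]
lemma scalarHom_tmul (f : A →ₐ[ℂ] Matrix m m ℂ) (τ : B →ₐ[ℂ] C) (a : A) (b : B) (i j : m) :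
    scalarHom f τ (a ⊗ₜ b) i j = f a i j • τ b := rfl

end Series

/-! ### The representations `ρ ⊗ ρ`, `ρ ⊗ σ` and `ρ ⊗ ρ ⊗ σ` -/

section Universal

variable {g : Type*} [LieRing g] [LieAlgebra ℂ g]

/-- `U𝐠` is generated by `𝐠`. -/
lemma subalgebra_eq_top_of_inc_mem (S : Subalgebra ℂ (Ug g)) (h : ∀ x : g, inc x ∈ S) : S = ⊤ := by
  let j : g →ₗ⁅ℂ⁆ S :=
    { toFun := fun x => ⟨inc x, h x⟩
      map_add' := fun x y => Subtype.ext (map_add (UniversalEnvelopingAlgebra.ι ℂ) x y)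
      map_smul' := fun c x => Subtype.ext (map_smul (UniversalEnvelopingAlgebra.ι ℂ) c x)
      map_lie' := fun {x y} => Subtype.ext (inc_lie x y) }
  have key : S.val.comp (UniversalEnvelopingAlgebra.lift ℂ j) = AlgHom.id ℂ (Ug g) := by
    ext x
    change ((UniversalEnvelopingAlgebra.lift ℂ j) (UniversalEnvelopingAlgebra.ι ℂ x) : Ug g) = _
    rw [UniversalEnvelopingAlgebra.lift_ι_apply]
    rfl
  refine eq_top_iff.2 fun x _ => ?_
  have := congrArg (fun f : Ug g →ₐ[ℂ] Ug g => f x) key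
  change ((UniversalEnvelopingAlgebra.lift ℂ j x : S) : Ug g) = x at this
  rw [← this]
  exact (UniversalEnvelopingAlgebra.lift ℂ j x).2

lemma comul_inc (x : g) : comul g (inc x) = inc x ⊗ₜ[ℂ] 1 + 1 ⊗ₜ[ℂ] inc x := by
  unfold comul inc
  rw [UniversalEnvelopingAlgebra.lift_ι_apply]
  rfl

variable {ι : Type*} [Fintype ι] [DecidableEq ι] (s : ℤˣ) (ρ : g →ₗ⁅ℂ⁆ Matrix ι ι ℂ)

lemma rep_inc (x : g) : rep ρ (inc x) = ρ x := UniversalEnvelopingAlgebra.lift_ι_apply ℂ ρ x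

lemma sigma_inc (x : g) : sigma s ρ (inc x) = jordanSchwinger s ρ x :=
  UniversalEnvelopingAlgebra.lift_ι_apply ℂ (jordanSchwinger s ρ) x

/-- `ρ ⊗ σ` as a representation of `U𝐠 ⊗ U𝐠`. -/
def rhoSigmaHom : Ug2 g →ₐ[ℂ] Matrix ι ι (Heis ι s) := scalarHom (rep ρ) (sigma s ρ)

/-- `ρ ⊗ ρ ⊗ σ` as a representation of `U𝐠 ⊗ U𝐠 ⊗ U𝐠`. -/
def rhoRhoSigmaHom : Ug3 g →ₐ[ℂ] Matrix (ι × ι) (ι × ι) (Heis ι s) :=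
  kronHom (rep ρ) (rhoSigmaHom s ρ)

lemma rhoSigma_eq_matSeries (p : PowerSeries (Ug2 g)) :
    rhoSigma s ρ p = matSeries (rhoSigmaHom s ρ) p := by
  ext i j N
  rw [coeff_matSeries]
  simp only [rhoSigma, mapCoeff, Matrix.of_apply, PowerSeries.coeff_mk]
  induction PowerSeries.coeff N p using TensorProduct.induction_on with
  | zero => simp
  | tmul x y => rfl
  | add x y hx hy => simp only [map_add, hx, hy, Matrix.add_apply]

lemma rhoRhoSigma_eq_matSeries (p : PowerSeries (Ug3 g)) :
    rhoRhoSigma s ρ p = matSeries (rhoRhoSigmaHom s ρ) p := by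
  ext i j N
  rw [coeff_matSeries]
  simp only [rhoRhoSigma, mapCoeff, Matrix.of_apply, PowerSeries.coeff_mk]
  induction PowerSeries.coeff N p using TensorProduct.induction_on with
  | zero => simp
  | add x y hx hy => simp only [map_add, hx, hy, Matrix.add_apply]
  | tmul x w =>
    induction w using TensorProduct.induction_on with
    | zero => simp
    | tmul y z => rfl
    | add w w' hw hw' => simp only [TensorProduct.tmul_add, map_add, hw, hw', Matrix.add_apply]

lemma rhoRho_eq_kronHom (w : Ug2 g) : rhoRho ρ w = kronHom (rep ρ) (rep ρ) w := by
  ext i j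
  simp only [rhoRho, Matrix.of_apply]
  induction w using TensorProduct.induction_on with
  | zero => simp
  | tmul x y => rfl
  | add x y hx hy => simp only [map_add, hx, hy, Matrix.add_apply]

lemma rhoRhoSeries_eq_matSeries (p : PowerSeries (Ug2 g)) :
    rhoRhoSeries ρ p = matSeries (kronHom (rep ρ) (rep ρ)) p := by
  ext i j N
  rw [coeff_matSeries, ← rhoRho_eq_kronHom]
  simp [rhoRhoSeries]

/-! ### The legs of `ρ ⊗ ρ ⊗ σ` -/

/-- On `w ⊗ 1` the representation `ρ ⊗ ρ ⊗ σ` is the numerical matrix `ρ^{⊗2}(w)`. -/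
lemma rhoRhoSigmaHom_leg12 (w : Ug2 g) :
    rhoRhoSigmaHom s ρ (leg12 g w) = (kronHom (rep ρ) (rep ρ) w).map (algebraMap ℂ _) := by
  ext i j
  rw [Matrix.map_apply]
  induction w using TensorProduct.induction_on with
  | zero => simp
  | tmul x y =>
    simp [leg12, rhoRhoSigmaHom, rhoSigmaHom, Algebra.algebraMap_eq_smul_one, mul_smul]
  | add x y hx hy => simp only [map_add, hx, hy, Matrix.add_apply]

lemma matSeries_leg12 (p : PowerSeries (Ug2 g)) :
    matSeries (rhoRhoSigmaHom s ρ) (PowerSeries.map (leg12 g).toRingHom p) =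
      (rhoRhoSeries ρ p).map scal := by
  ext i j N
  rw [coeff_matSeries, PowerSeries.coeff_map, Matrix.map_apply, scal, PowerSeries.coeff_map,
    rhoRhoSeries_eq_matSeries, coeff_matSeries]
  exact congrFun (congrFun (rhoRhoSigmaHom_leg12 s ρ _) i) j

lemma matSeries_leg23_apply (p : PowerSeries (Ug2 g)) (i j : ι × ι) :
    matSeries (rhoRhoSigmaHom s ρ) (PowerSeries.map (leg23 g).toRingHom p) i j =
      if i.1 = j.1 then rhoSigma s ρ p i.2 j.2 else 0 := by
  ext N
  rw [coeff_matSeries, PowerSeries.coeff_map, rhoSigma_eq_matSeries]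
  change rhoRhoSigmaHom s ρ (1 ⊗ₜ[ℂ] PowerSeries.coeff N p) i j = _
  rw [rhoRhoSigmaHom, kronHom_tmul, map_one, Matrix.one_apply]
  split_ifs <;> simp [coeff_matSeries]

lemma rhoRhoSigmaHom_assoc_tmul (w : Ug2 g) (y : Ug g) (i j : ι × ι) :
    rhoRhoSigmaHom s ρ (Algebra.TensorProduct.assoc ℂ ℂ ℂ (Ug g) (Ug g) (Ug g) (w ⊗ₜ y)) i j =
      kronHom (rep ρ) (rep ρ) w i j • sigma s ρ y := by
  induction w using TensorProduct.induction_on with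
  | zero => simp
  | tmul x x' => simp [rhoRhoSigmaHom, rhoSigmaHom, mul_smul]
  | add x y hx hy => simp only [map_add, TensorProduct.add_tmul, hx, hy, Matrix.add_apply, add_smul]

/-- The coefficients of `U` commute with `ρ^{⊗2}(Δ x)`. -/
lemma CommutesWithCoproduct.coeff {U : Matrix (ι × ι) (ι × ι) (PowerSeries ℂ)}
    (hU : CommutesWithCoproduct ρ U) (x : Ug g) (N : ℕ) :
    Commute (U.map (PowerSeries.coeff N)) (kronHom (rep ρ) (rep ρ) (comul g x)) := by
  ext i j
  have h := congrArg (PowerSeries.coeff N) (congrFun (congrFun (hU x).eq i) j)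
  rw [rhoRho_eq_kronHom] at h
  simpa [Matrix.mul_apply] using h

lemma CommutesWithCoproduct.comulId {U : Matrix (ι × ι) (ι × ι) (PowerSeries ℂ)}
    (hU : CommutesWithCoproduct ρ U) (w : Ug2 g) (N : ℕ) :
    Commute ((U.map (PowerSeries.coeff N)).map (algebraMap ℂ (Heis ι s)))
      (rhoRhoSigmaHom s ρ (comulId g w)) := by
  induction w using TensorProduct.induction_on with
  | zero => simp
  | add x y hx hy => rw [map_add, map_add]; exact hx.add_right hy
  | tmul x y =>
    ext i j
    have h := congrFun (congrFun (hU.coeff ρ x N).eq i) j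
    simp only [Matrix.mul_apply, Matrix.map_apply] at h ⊢
    have e : ∀ p q, rhoRhoSigmaHom s ρ (QHeis.comulId g (x ⊗ₜ y)) p q =
        kronHom (rep ρ) (rep ρ) (comul g x) p q • sigma s ρ y :=
      rhoRhoSigmaHom_assoc_tmul s ρ (comul g x) y
    simp only [e, Algebra.algebraMap_eq_smul_one, smul_mul_smul_comm, one_mul, mul_one,
      ← Finset.sum_smul]
    rw [h]

/-- A numerical matrix commuting with `ρ^{⊗2}(Δ(U𝐠))` commutes with `(ρ ⊗ ρ ⊗ σ)((Δ ⊗ id) p)`. -/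
lemma CommutesWithCoproduct.matSeries {U : Matrix (ι × ι) (ι × ι) (PowerSeries ℂ)}
    (hU : CommutesWithCoproduct ρ U) (p : PowerSeries (Ug2 g)) :
    Commute (U.map scal)
      (matSeries (rhoRhoSigmaHom s ρ) (PowerSeries.map (QHeis.comulId g).toRingHom p)) := by
  have e : ∀ N, (U.map (scal (B := Heis ι s))).map (PowerSeries.coeff N) =
      (U.map (PowerSeries.coeff N)).map (algebraMap ℂ (Heis ι s)) := fun N => by
    ext i j
    simp [scal]
  refine matrix_series_ext fun N => ?_
  rw [matrix_map_coeff_mul, matrix_map_coeff_mul, ← Finset.Nat.sum_antidiagonal_swap]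
  refine Finset.sum_congr rfl fun q _ => ?_
  simp only [Prod.fst_swap, Prod.snd_swap, map_coeff_matSeries, e, PowerSeries.coeff_map]
  exact (hU.comulId s ρ _ _).eq

end Universal

/-! ### Covariance of the dressed generators -/

section Covariance

variable {g : Type*} [LieRing g] [LieAlgebra ℂ g] {ι : Type*} [Fintype ι] [DecidableEq ι]
  (s : ℤˣ) (ρ : g →ₗ⁅ℂ⁆ Matrix ι ι ℂ)

/-- A family in `𝓐_±` that transforms like the generators `a^i`:
`b^i σ(x) = σ(x) b^i + ρ(x)^i_k b^k` for `x ∈ 𝐠`. -/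
def IsLowerTensor (b : ι → Heis ι s) : Prop :=
  ∀ (x : g) (i : ι), b i * jordanSchwinger s ρ x =
    jordanSchwinger s ρ x * b i + ∑ k, ρ x i k • b k

/-- A family in `𝓐_±` that transforms like the generators `a⁺_i`:
`σ(x) b_i = b_i σ(x) + ρ(x)^k_i b_k` for `x ∈ 𝐠`. -/
def IsUpperTensor (b : ι → Heis ι s) : Prop :=
  ∀ (x : g) (i : ι), jordanSchwinger s ρ x * b i =
    b i * jordanSchwinger s ρ x + ∑ k, ρ x k i • b k

section Dressing

variable {s ρ}

/-- Elements of `𝐠` act by commutators with `σ(x)`, so invariants commute with `σ(x)`. -/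
lemma IsInvariant.commute {I : PowerSeries (Heis ι s)} (hI : IsInvariant s ρ I) (x : g) :
    Commute (PowerSeries.C (jordanSchwinger s ρ x)) I := by
  ext N
  have h := congrArg (PowerSeries.coeff N) (hI (inc x))
  have h0 : counit g (inc x) = 0 := UniversalEnvelopingAlgebra.lift_ι_apply ℂ (0 : g →ₗ⁅ℂ⁆ ℂ) x
  rw [h0, zero_smul, mapCoeff, PowerSeries.coeff_mk, act_inc, map_zero, sub_eq_zero] at h
  rw [PowerSeries.coeff_C_mul, PowerSeries.coeff_mul_C, h]

/-- The commutator with `σ(x)` passes through a dressing by invariants; the dressing may vary from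
block to block because the coefficients `d` link only indices of one block. -/
lemma commutator_coeff_dressed {κ : Type*} {I J : κ → PowerSeries (Heis ι s)}
    (hI : ∀ b, IsInvariant s ρ (I b)) (hJ : ∀ b, IsInvariant s ρ (J b)) {c : ι → κ} {d : ι → ℂ}
    {e : ι → Heis ι s} {i : ι} (hd : ∀ k, c i ≠ c k → d k = 0) {x : g}
    (h : jordanSchwinger s ρ x * e i - e i * jordanSchwinger s ρ x = ∑ k, d k • e k) (N : ℕ) :
    jordanSchwinger s ρ x * PowerSeries.coeff N (I (c i) * PowerSeries.C (e i) * J (c i)) -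
        PowerSeries.coeff N (I (c i) * PowerSeries.C (e i) * J (c i)) * jordanSchwinger s ρ x =
      ∑ k, d k • PowerSeries.coeff N (I (c k) * PowerSeries.C (e k) * J (c k)) := by
  rw [← PowerSeries.coeff_C_mul, ← PowerSeries.coeff_mul_C, ← map_sub]
  have h₁ : PowerSeries.C (jordanSchwinger s ρ x) * (I (c i) * PowerSeries.C (e i) * J (c i)) -
      I (c i) * PowerSeries.C (e i) * J (c i) * PowerSeries.C (jordanSchwinger s ρ x) =
      I (c i) * PowerSeries.C (∑ k, d k • e k) * J (c i) := by
    rw [← h, map_sub, map_mul, map_mul, mul_sub, sub_mul]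
    congr 1
    · simp only [← mul_assoc, ((hI (c i)).commute x).eq]
    · simp only [mul_assoc, ((hJ (c i)).commute x).eq]
  rw [h₁, map_sum, Finset.mul_sum, Finset.sum_mul, map_sum]
  refine Finset.sum_congr rfl fun k _ => ?_
  by_cases hk : c i = c k
  · have h₂ : PowerSeries.C (d k • e k) = d k • PowerSeries.C (e k) := by
      ext n
      rw [PowerSeries.coeff_smul, PowerSeries.coeff_C, PowerSeries.coeff_C, smul_ite, smul_zero]
    rw [hk, ← PowerSeries.coeff_smul, h₂, mul_smul_comm, smul_mul_assoc]
  · simp [hd k hk]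

lemma isLowerTensor_coeff_dressedLow {κ : Type*} {c : ι → κ}
    (hc : ∀ (x : g) (i j : ι), c i ≠ c j → ρ x i j = 0) {u uHat : κ → PowerSeries (Heis ι s)}
    (hu : ∀ b, IsInvariant s ρ (u b)) (huHat : ∀ b, IsInvariant s ρ (uHat b)) (N : ℕ) :
    IsLowerTensor s ρ fun i => PowerSeries.coeff N (dressedLow s c u uHat i) := by
  intro x i
  have h := act_aLow s ρ x i
  simp only [act_inc, ← Finset.sum_neg_distrib, ← neg_smul] at h
  have := commutator_coeff_dressed hu huHat (c := c) (e := aLow s)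
    (fun k hk => by rw [hc x i k hk, neg_zero]) h N
  simp only [neg_smul, Finset.sum_neg_distrib] at this
  rw [sub_eq_iff_eq_add] at this
  simp only [dressedLow]
  rw [this]
  abel

lemma isUpperTensor_coeff_dressedUp {κ : Type*} {c : ι → κ}
    (hc : ∀ (x : g) (i j : ι), c i ≠ c j → ρ x i j = 0) {v vHat : κ → PowerSeries (Heis ι s)}
    (hv : ∀ b, IsInvariant s ρ (v b)) (hvHat : ∀ b, IsInvariant s ρ (vHat b)) (N : ℕ) :
    IsUpperTensor s ρ fun i => PowerSeries.coeff N (dressedUp s c v vHat i) := by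
  intro x i
  have h := act_aUp s ρ x i
  rw [act_inc] at h
  have := commutator_coeff_dressed hv hvHat (c := c) (e := aUp s)
    (fun k hk => hc x k i (Ne.symm hk)) h N
  rw [sub_eq_iff_eq_add'] at this
  exact this

end Dressing

lemma rhoSigmaHom_comul_inc (x : g) (i k : ι) :
    rhoSigmaHom s ρ (comul g (inc x)) i k =
      ρ x i k • 1 + if i = k then jordanSchwinger s ρ x else 0 := by
  rw [comul_inc, map_add, Matrix.add_apply, rhoSigmaHom, scalarHom_tmul, scalarHom_tmul, map_one,
    map_one, rep_inc, sigma_inc, Matrix.one_apply, ite_smul, one_smul, zero_smul]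

variable {s ρ}

/-- The exchange rule `b^i σ(y) = (ρ ⊗ σ)(Δ y)^i_k b^k`. -/
lemma IsLowerTensor.mul_sigma {b : ι → Heis ι s} (hb : IsLowerTensor s ρ b) (y : Ug g) (i : ι) :
    b i * sigma s ρ y = ∑ k, rhoSigmaHom s ρ (comul g y) i k * b k := by
  let S : Subalgebra ℂ (Ug g) :=
    { carrier := {y | ∀ i, b i * sigma s ρ y = ∑ k, rhoSigmaHom s ρ (comul g y) i k * b k}
      mul_mem' := fun {y z} hy hz i => by
        simp only [Set.mem_ofPred_eq] at hy hz
        rw [map_mul, ← mul_assoc, hy, Finset.sum_mul]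
        simp only [mul_assoc, hz, map_mul, Matrix.mul_apply, Finset.sum_mul, Finset.mul_sum]
        exact Finset.sum_comm
      add_mem' := fun {y z} hy hz i => by
        simp only [Set.mem_ofPred_eq] at hy hz
        simp only [map_add, mul_add, hy, hz, Matrix.add_apply, add_mul, Finset.sum_add_distrib]
      algebraMap_mem' := fun r i => by
        simp only [AlgHom.commutes, Matrix.algebraMap_matrix_apply, ite_mul, zero_mul,
          Finset.sum_ite_eq, Finset.mem_univ, if_true]
        exact (Algebra.commutes r (b i)).symm }
  have hS : S = ⊤ := subalgebra_eq_top_of_inc_mem S fun x i => by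
    simp only [rhoSigmaHom_comul_inc, sigma_inc, hb x i, add_mul, ite_mul, zero_mul,
      Finset.sum_add_distrib, Finset.sum_ite_eq, Finset.mem_univ, if_true, smul_mul_assoc, one_mul]
    exact add_comm _ _
  exact (hS ▸ Algebra.mem_top : y ∈ S) i

/-- The exchange rule `σ(y) b_i = b_k (ρ ⊗ σ)(Δ y)^k_i`. -/
lemma IsUpperTensor.sigma_mul {b : ι → Heis ι s} (hb : IsUpperTensor s ρ b) (y : Ug g) (i : ι) :
    sigma s ρ y * b i = ∑ k, b k * rhoSigmaHom s ρ (comul g y) k i := by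
  let S : Subalgebra ℂ (Ug g) :=
    { carrier := {y | ∀ i, sigma s ρ y * b i = ∑ k, b k * rhoSigmaHom s ρ (comul g y) k i}
      mul_mem' := fun {y z} hy hz i => by
        simp only [Set.mem_ofPred_eq] at hy hz
        rw [map_mul, mul_assoc, hz, Finset.mul_sum]
        simp only [← mul_assoc, hy, map_mul, Matrix.mul_apply, Finset.sum_mul, Finset.mul_sum]
        exact Finset.sum_comm
      add_mem' := fun {y z} hy hz i => by
        simp only [Set.mem_ofPred_eq] at hy hz
        simp only [map_add, add_mul, hy, hz, Matrix.add_apply, mul_add, Finset.sum_add_distrib]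
      algebraMap_mem' := fun r i => by
        simp only [AlgHom.commutes, Matrix.algebraMap_matrix_apply, mul_ite, mul_zero,
          Finset.sum_ite_eq', Finset.mem_univ, if_true]
        exact Algebra.commutes r (b i) }
  have hS : S = ⊤ := subalgebra_eq_top_of_inc_mem S fun x i => by
    simp only [rhoSigmaHom_comul_inc, sigma_inc, hb x i, mul_add, mul_ite, mul_zero,
      Finset.sum_add_distrib, Finset.sum_ite_eq', Finset.mem_univ, if_true, mul_smul_comm, mul_one]
    exact add_comm _ _
  exact (hS ▸ Algebra.mem_top : y ∈ S) i

lemma rhoRhoSigmaHom_tmul (x : Ug g) (w : Ug2 g) (p q : ι × ι) :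
    rhoRhoSigmaHom s ρ (x ⊗ₜ w) p q = rep ρ x p.1 q.1 • rhoSigmaHom s ρ w p.2 q.2 := rfl

lemma IsLowerTensor.mul_rhoSigmaHom {b : ι → Heis ι s} (hb : IsLowerTensor s ρ b) (w : Ug2 g)
    (i j m : ι) : b m * rhoSigmaHom s ρ w i j =
      ∑ k, rhoRhoSigmaHom s ρ (idComul g w) (i, m) (j, k) * b k := by
  induction w using TensorProduct.induction_on with
  | zero => simp
  | tmul x y =>
    have e : idComul g (x ⊗ₜ y) = x ⊗ₜ comul g y := rfl
    simp only [e, rhoSigmaHom, scalarHom_tmul, mul_smul_comm, hb.mul_sigma, rhoRhoSigmaHom_tmul,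
      smul_mul_assoc, Finset.smul_sum]
  | add x y hx hy =>
    simp only [map_add, Matrix.add_apply, mul_add, hx, hy, add_mul, Finset.sum_add_distrib]

lemma IsUpperTensor.rhoSigmaHom_mul {b : ι → Heis ι s} (hb : IsUpperTensor s ρ b) (w : Ug2 g)
    (i j m : ι) : rhoSigmaHom s ρ w i j * b m =
      ∑ k, b k * rhoRhoSigmaHom s ρ (idComul g w) (i, k) (j, m) := by
  induction w using TensorProduct.induction_on with
  | zero => simp
  | tmul x y =>
    have e : idComul g (x ⊗ₜ y) = x ⊗ₜ comul g y := rfl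
    simp only [e, rhoSigmaHom, scalarHom_tmul, smul_mul_assoc, hb.sigma_mul, rhoRhoSigmaHom_tmul,
      mul_smul_comm, Finset.smul_sum]
  | add x y hx hy =>
    simp only [map_add, Matrix.add_apply, add_mul, hx, hy, mul_add, Finset.sum_add_distrib]

end Covariance

/-! ### Block matrices of generators -/

section Blocks

variable {R ι : Type*} [Ring R] [Fintype ι] [DecidableEq ι]

/-- The matrix `1 ⊗ b` with entries `δ^i_j b^m`, for a column `b` of elements of `R`. -/
def colBlock (b : ι → R) : Matrix (ι × ι) ι R := Matrix.of fun p j => if p.1 = j then b p.2 else 0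

/-- The matrix `1 ⊗ b` with entries `δ^i_j b_m`, for a row `b` of elements of `R`. -/
def rowBlock (b : ι → R) : Matrix ι (ι × ι) R := Matrix.of fun i q => if i = q.1 then b q.2 else 0

lemma colBlock_mul_apply (b : ι → R) (X : Matrix ι ι R) (p : ι × ι) (j : ι) :
    (colBlock b * X) p j = b p.2 * X p.1 j := by
  simp [colBlock, Matrix.mul_apply]

lemma mul_colBlock_apply {n : Type*} (X : Matrix n (ι × ι) R) (b : ι → R) (p : n) (j : ι) :
    (X * colBlock b) p j = ∑ k, X p (j, k) * b k := by
  simp [colBlock, Matrix.mul_apply, Fintype.sum_prod_type_right]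

lemma mul_rowBlock_apply (X : Matrix ι ι R) (b : ι → R) (i : ι) (q : ι × ι) :
    (X * rowBlock b) i q = X i q.1 * b q.2 := by
  simp [rowBlock, Matrix.mul_apply]

lemma rowBlock_mul_apply {n : Type*} (b : ι → R) (X : Matrix (ι × ι) n R) (i : ι) (q : n) :
    (rowBlock b * X) i q = ∑ k, b k * X (i, k) q := by
  simp [rowBlock, Matrix.mul_apply, Fintype.sum_prod_type_right]

lemma colBlock_mulVec (b d : ι → R) (p : ι × ι) : (colBlock b).mulVec d p = b p.2 * d p.1 := by
  simp [colBlock, Matrix.mulVec, dotProduct]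

lemma vecMul_rowBlock (b d : ι → R) (p : ι × ι) :
    Matrix.vecMul d (rowBlock b) p = d p.1 * b p.2 := by
  simp [rowBlock, Matrix.vecMul, dotProduct]

end Blocks

section BlockCovariance

variable {g : Type*} [LieRing g] [LieAlgebra ℂ g] {ι : Type*} [Fintype ι] [DecidableEq ι]
  {s : ℤˣ} {ρ : g →ₗ⁅ℂ⁆ Matrix ι ι ℂ}

/-- Moving `(ρ ⊗ σ)(p)` to the left of the `a^m` turns `p` into `(id ⊗ Δ) p`. -/
lemma colBlock_mul_rhoSigma {a : ι → PowerSeries (Heis ι s)}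
    (ha : ∀ N, IsLowerTensor s ρ fun i => PowerSeries.coeff N (a i)) (p : PowerSeries (Ug2 g)) :
    colBlock a * rhoSigma s ρ p =
      matSeries (rhoRhoSigmaHom s ρ) (PowerSeries.map (idComul g).toRingHom p) * colBlock a := by
  ext ⟨i, m⟩ j N
  rw [colBlock_mul_apply, mul_colBlock_apply, rhoSigma_eq_matSeries, map_sum]
  simp only [PowerSeries.coeff_mul, coeff_matSeries, PowerSeries.coeff_map]
  rw [← Finset.Nat.sum_antidiagonal_swap, Finset.sum_comm]
  exact Finset.sum_congr rfl fun q _ => (ha q.2).mul_rhoSigmaHom _ i j m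

/-- Moving `(ρ ⊗ σ)(p)` to the right of the `a⁺_m` turns `p` into `(id ⊗ Δ) p`. -/
lemma rhoSigma_mul_rowBlock {a : ι → PowerSeries (Heis ι s)}
    (ha : ∀ N, IsUpperTensor s ρ fun i => PowerSeries.coeff N (a i)) (p : PowerSeries (Ug2 g)) :
    rhoSigma s ρ p * rowBlock a =
      rowBlock a * matSeries (rhoRhoSigmaHom s ρ) (PowerSeries.map (idComul g).toRingHom p) := by
  ext i ⟨j, m⟩ N
  rw [mul_rowBlock_apply, rowBlock_mul_apply, rhoSigma_eq_matSeries, map_sum]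
  simp only [PowerSeries.coeff_mul, coeff_matSeries, PowerSeries.coeff_map]
  rw [← Finset.Nat.sum_antidiagonal_swap, Finset.sum_comm]
  exact Finset.sum_congr rfl fun q _ => (ha q.1).rhoSigmaHom_mul _ i j m

lemma colBlock_rhoSigma_mulVec (a : ι → PowerSeries (Heis ι s)) (p : PowerSeries (Ug2 g)) :
    colBlock ((rhoSigma s ρ p).mulVec a) =
      matSeries (rhoRhoSigmaHom s ρ) (PowerSeries.map (leg23 g).toRingHom p) * colBlock a := by
  ext1 i j
  rw [mul_colBlock_apply]
  simp only [matSeries_leg23_apply, colBlock, Matrix.of_apply]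
  split_ifs <;> simp [Matrix.mulVec, dotProduct]

lemma rowBlock_vecMul_rhoSigma (a : ι → PowerSeries (Heis ι s)) (p : PowerSeries (Ug2 g)) :
    rowBlock (Matrix.vecMul a (rhoSigma s ρ p)) =
      rowBlock a * matSeries (rhoRhoSigmaHom s ρ) (PowerSeries.map (leg23 g).toRingHom p) := by
  ext1 i j
  rw [rowBlock_mul_apply]
  simp only [matSeries_leg23_apply, rowBlock, Matrix.of_apply]
  split_ifs <;> simp [Matrix.vecMul, dotProduct]

end BlockCovariance

/-! ### Dressing and undressing the commutation relations -/

section Relations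

variable {R : Type*} [Ring R] {ι : Type*} [Fintype ι] [DecidableEq ι]

lemma mulVec_relation_iff (s : ℤ) {Q Q' P : Matrix ι ι R} (hQ : Q * Q' = 1) (hQ' : Q' * Q = 1)
    (w : ι → R) :
    Q.mulVec w = s • P.mulVec (Q.mulVec w) ↔ w = s • (Q' * P * Q).mulVec w := by
  constructor <;> intro h
  · have := congrArg Q'.mulVec h
    rwa [Matrix.mulVec_smul, Matrix.mulVec_mulVec, hQ', Matrix.one_mulVec, Matrix.mulVec_mulVec,
      Matrix.mulVec_mulVec] at this
  · have := congrArg Q.mulVec h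
    rw [Matrix.mulVec_smul, Matrix.mulVec_mulVec, ← Matrix.mul_assoc, ← Matrix.mul_assoc, hQ,
      Matrix.one_mul] at this
    rwa [Matrix.mulVec_mulVec]

lemma vecMul_relation_iff (s : ℤ) {Q Q' P : Matrix ι ι R} (hQ : Q * Q' = 1) (hQ' : Q' * Q = 1)
    (w : ι → R) :
    Matrix.vecMul w Q' = s • Matrix.vecMul (Matrix.vecMul w Q') P ↔
      w = s • Matrix.vecMul w (Q' * P * Q) := by
  constructor <;> intro h
  · have := congrArg (Matrix.vecMul · Q) h
    simpa only [Matrix.smul_vecMul, Matrix.vecMul_vecMul, hQ', Matrix.vecMul_one,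
      Matrix.mul_assoc] using this
  · have := congrArg (Matrix.vecMul · Q') h
    simpa only [Matrix.smul_vecMul, Matrix.vecMul_vecMul, hQ, Matrix.mul_one,
      Matrix.mul_assoc] using this

/-- Conjugation by `N` leaves the term `1` of the mixed relation in place. -/
lemma conj_relation_iff (s : ℤ) {N N' X Y Z : Matrix ι ι R} (hN : N * N' = 1) (hN' : N' * N = 1)
    (hZ : N' * Z * N = Y) : N * X * N' = 1 + s • Z ↔ X = 1 + s • Y := by
  subst hZ
  constructor <;> intro h
  · have := congrArg (N' * · * N) h
    simp only [mul_add, add_mul, mul_one, hN', mul_smul_comm, smul_mul_assoc] at this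
    rw [← this]
    simp only [← mul_assoc, hN', one_mul]
    rw [mul_assoc, hN', mul_one]
  · rw [h]
    simp only [mul_add, add_mul, mul_one, hN, mul_smul_comm, smul_mul_assoc]
    congr 2
    simp only [← mul_assoc, hN, one_mul]
    rw [mul_assoc, hN, mul_one]

lemma ringInverse_eq_of_mul_eq_one {x y : R} (h : x * y = 1) (h' : y * x = 1) :
    Ring.inverse x = y :=
  Ring.inverse_unit (⟨x, y, h, h'⟩ : Rˣ)

end Relations

/-- Numerical series are central in `B[[h]]`. -/
lemma scal_commute {B : Type*} [Ring B] [Algebra ℂ B] (c : PowerSeries ℂ) (p : PowerSeries B) :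
    Commute (scal c) p := by
  ext N
  rw [PowerSeries.coeff_mul, PowerSeries.coeff_mul, ← Finset.Nat.sum_antidiagonal_swap]
  refine Finset.sum_congr rfl fun q _ => ?_
  simp only [scal, PowerSeries.coeff_map, Prod.fst_swap, Prod.snd_swap]
  exact Algebra.commutes _ _

/-! ### The tower matrix of a twist -/

section Twist

variable {g : Type*} [LieRing g] [LieAlgebra ℂ g] {ι : Type*} [Fintype ι] [DecidableEq ι]
  (s : ℤˣ) (ρ : g →ₗ⁅ℂ⁆ Matrix ι ι ℂ)

/-- The matrix `(ρ ⊗ ρ ⊗ σ)((1 ⊗ F)(id ⊗ Δ)(F))`. -/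
def towerMatrix (F : PowerSeries (Ug2 g)) : Matrix (ι × ι) (ι × ι) (PowerSeries (Heis ι s)) :=
  matSeries (rhoRhoSigmaHom s ρ)
    (PowerSeries.map (leg23 g).toRingHom F * PowerSeries.map (idComul g).toRingHom F)

/-- The matrix `(ρ ⊗ ρ ⊗ σ)((id ⊗ Δ)(F⁻¹)(1 ⊗ F⁻¹))`, inverse to `towerMatrix`. -/
def towerInv (F : PowerSeries (Ug2 g)) : Matrix (ι × ι) (ι × ι) (PowerSeries (Heis ι s)) :=
  matSeries (rhoRhoSigmaHom s ρ)
    (PowerSeries.map (idComul g).toRingHom (Ring.inverse F) *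
      PowerSeries.map (leg23 g).toRingHom (Ring.inverse F))

variable {F : PowerSeries (Ug2 g)}

lemma map_mul_map_eq_one {A B : Type*} [Ring A] [Ring B] (f : A →+* B) {x y : PowerSeries A}
    (h : x * y = 1) : PowerSeries.map f x * PowerSeries.map f y = 1 := by
  rw [← map_mul, h, map_one]

lemma towerMatrix_mul_towerInv (hF : IsUnit F) : towerMatrix s ρ F * towerInv s ρ F = 1 := by
  rw [towerMatrix, towerInv, ← map_mul, mul_assoc,
    ← mul_assoc (PowerSeries.map (idComul g).toRingHom F),
    map_mul_map_eq_one _ (Ring.mul_inverse_cancel F hF), one_mul,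
    map_mul_map_eq_one _ (Ring.mul_inverse_cancel F hF), map_one]

lemma towerInv_mul_towerMatrix (hF : IsUnit F) : towerInv s ρ F * towerMatrix s ρ F = 1 := by
  rw [towerMatrix, towerInv, ← map_mul, mul_assoc,
    ← mul_assoc (PowerSeries.map (leg23 g).toRingHom (Ring.inverse F)),
    map_mul_map_eq_one _ (Ring.inverse_mul_cancel F hF), one_mul,
    map_mul_map_eq_one _ (Ring.inverse_mul_cancel F hF), map_one]

lemma map_scal_twistedMatrix (hF : IsUnit F) (U : Matrix (ι × ι) (ι × ι) (PowerSeries ℂ)) :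
    (twistedMatrix ρ F U).map (scal (B := Heis ι s)) =
      (rhoRhoSeries ρ F).map scal * U.map scal * (rhoRhoSeries ρ (Ring.inverse F)).map scal := by
  have h : (rhoRhoSeries ρ F)⁻¹ = rhoRhoSeries ρ (Ring.inverse F) := by
    refine Matrix.inv_eq_right_inv ?_
    rw [rhoRhoSeries_eq_matSeries, rhoRhoSeries_eq_matSeries, ← map_mul,
      Ring.mul_inverse_cancel F hF, map_one]
  rw [twistedMatrix, h]
  exact ((Matrix.map_mul (f := PowerSeries.map (algebraMap ℂ (Heis ι s)))).trans
    (congrArg (· * _) Matrix.map_mul))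

/-- Since `M` differs from the tower matrix by `F⁻¹` and by the matrix of `(Δ ⊗ id)(F⁻¹)`, with
which `U` commutes, conjugating `U` with `M` conjugates `F U F⁻¹` with the tower matrix. -/
lemma dressedMatrix_coassociator (hF : IsUnit F) {U : Matrix (ι × ι) (ι × ι) (PowerSeries ℂ)}
    (hU : CommutesWithCoproduct ρ U) :
    dressedMatrix (rhoRhoSigma s ρ (coassociator F)) U =
      towerInv s ρ F * (twistedMatrix ρ F U).map scal * towerMatrix s ρ F := by
  set D := matSeries (rhoRhoSigmaHom s ρ) (PowerSeries.map (comulId g).toRingHom F) with hD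
  set D' := matSeries (rhoRhoSigmaHom s ρ)
    (PowerSeries.map (comulId g).toRingHom (Ring.inverse F)) with hD'
  set f := matSeries (rhoRhoSigmaHom s ρ) (PowerSeries.map (leg12 g).toRingHom F) with hf
  set f' := matSeries (rhoRhoSigmaHom s ρ)
    (PowerSeries.map (leg12 g).toRingHom (Ring.inverse F)) with hf'
  have hDD : D * D' = 1 := by
    rw [hD, hD', ← map_mul, map_mul_map_eq_one _ (Ring.mul_inverse_cancel F hF), map_one]
  have hDD' : D' * D = 1 := by
    rw [hD, hD', ← map_mul, map_mul_map_eq_one _ (Ring.inverse_mul_cancel F hF), map_one]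
  have hff : f * f' = 1 := by
    rw [hf, hf', ← map_mul, map_mul_map_eq_one _ (Ring.mul_inverse_cancel F hF), map_one]
  have hff' : f' * f = 1 := by
    rw [hf, hf', ← map_mul, map_mul_map_eq_one _ (Ring.inverse_mul_cancel F hF), map_one]
  have hQ := towerMatrix_mul_towerInv s ρ hF
  have hQ' := towerInv_mul_towerMatrix s ρ hF
  have hM : rhoRhoSigma s ρ (coassociator F) = D' * f' * towerMatrix s ρ F := by
    rw [rhoRhoSigma_eq_matSeries, coassociator, mul_assoc, map_mul, map_mul, towerMatrix]
  have hM' : Ring.inverse (rhoRhoSigma s ρ (coassociator F)) = towerInv s ρ F * f * D := by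
    refine ringInverse_eq_of_mul_eq_one ?_ ?_
    · rw [hM]
      calc _ = D' * (f' * (towerMatrix s ρ F * towerInv s ρ F) * f) * D := by
            simp only [mul_assoc]
        _ = 1 := by rw [hQ, mul_one, hff', mul_one, hDD']
    · rw [hM]
      calc _ = towerInv s ρ F * (f * (D * D') * f') * towerMatrix s ρ F := by
            simp only [mul_assoc]
        _ = 1 := by rw [hDD, mul_one, hff, mul_one, hQ']
  have hUD : D * U.map scal * D' = U.map scal := by
    rw [← (hU.matSeries s ρ F).eq, mul_assoc, hDD, mul_one]
  rw [dressedMatrix, hM', hM, map_scal_twistedMatrix s ρ hF, ← matSeries_leg12, ← matSeries_leg12]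
  calc _ = towerInv s ρ F * (f * (D * U.map scal * D') * f') * towerMatrix s ρ F := by
        simp only [mul_assoc]
    _ = _ := by rw [hUD]

variable {s ρ}

lemma colBlock_mulVec_deformedLow {a : ι → PowerSeries (Heis ι s)}
    (ha : ∀ N, IsLowerTensor s ρ fun i => PowerSeries.coeff N (a i)) :
    (colBlock (deformedLow s ρ F a)).mulVec (deformedLow s ρ F a) =
      (towerMatrix s ρ F).mulVec ((colBlock a).mulVec a) := by
  have e : deformedLow s ρ F a = (rhoSigma s ρ F).mulVec a := rfl
  rw [e, colBlock_rhoSigma_mulVec, Matrix.mulVec_mulVec, Matrix.mul_assoc,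
    colBlock_mul_rhoSigma ha, ← Matrix.mul_assoc, ← map_mul, Matrix.mulVec_mulVec]
  rfl

lemma vecMul_rowBlock_deformedUp {a : ι → PowerSeries (Heis ι s)}
    (ha : ∀ N, IsUpperTensor s ρ fun i => PowerSeries.coeff N (a i)) :
    Matrix.vecMul (deformedUp s ρ F a) (rowBlock (deformedUp s ρ F a)) =
      Matrix.vecMul (Matrix.vecMul a (rowBlock a)) (towerInv s ρ F) := by
  have e : deformedUp s ρ F a = Matrix.vecMul a (rhoSigma s ρ (Ring.inverse F)) := rfl
  rw [e, rowBlock_vecMul_rhoSigma, Matrix.vecMul_vecMul, ← Matrix.mul_assoc,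
    rhoSigma_mul_rowBlock ha, Matrix.mul_assoc, ← map_mul, Matrix.vecMul_vecMul]
  rfl

lemma rowBlock_mul_colBlock_deformed {a aPlus : ι → PowerSeries (Heis ι s)}
    (ha : ∀ N, IsLowerTensor s ρ fun i => PowerSeries.coeff N (a i))
    (haPlus : ∀ N, IsUpperTensor s ρ fun i => PowerSeries.coeff N (aPlus i))
    (P : Matrix (ι × ι) (ι × ι) (PowerSeries (Heis ι s))) :
    rhoSigma s ρ (Ring.inverse F) * (rowBlock (deformedUp s ρ F aPlus) * P *
        colBlock (deformedLow s ρ F a)) * rhoSigma s ρ F =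
      rowBlock aPlus * (towerInv s ρ F * P * towerMatrix s ρ F) * colBlock a := by
  have e : deformedLow s ρ F a = (rhoSigma s ρ F).mulVec a := rfl
  have e' : deformedUp s ρ F aPlus = Matrix.vecMul aPlus (rhoSigma s ρ (Ring.inverse F)) := rfl
  rw [e, e', rowBlock_vecMul_rhoSigma, colBlock_rhoSigma_mulVec, towerInv, towerMatrix, map_mul,
    map_mul]
  simp only [Matrix.mul_assoc]
  rw [colBlock_mul_rhoSigma ha]
  simp only [← Matrix.mul_assoc]
  rw [rhoSigma_mul_rowBlock haPlus]

lemma vecMulVec_deformed (a aPlus : ι → PowerSeries (Heis ι s)) :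
    Matrix.vecMulVec (deformedLow s ρ F a) (deformedUp s ρ F aPlus) =
      rhoSigma s ρ F * Matrix.vecMulVec a aPlus * rhoSigma s ρ (Ring.inverse F) := by
  rw [Matrix.mul_vecMulVec, Matrix.vecMulVec_mul]
  rfl

end Twist

/-! ### The commutation relations in matrix form -/

section MatrixForm

variable {R ι : Type*} [Ring R] [Fintype ι] [DecidableEq ι] (s : ℤ)

lemma lower_relation_iff (P : Matrix (ι × ι) (ι × ι) R) (b : ι → R) :
    (∀ i j, b i * b j = s • ∑ h, ∑ k, P (j, i) (h, k) * (b k * b h)) ↔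
      (colBlock b).mulVec b = s • P.mulVec ((colBlock b).mulVec b) := by
  have e : ∀ p, P.mulVec ((colBlock b).mulVec b) p =
      ∑ h, ∑ k, P p (h, k) * (b k * b h) := fun p => by
    change ∑ q, P p q * (colBlock b).mulVec b q = _
    simp only [colBlock_mulVec, Fintype.sum_prod_type]
  rw [funext_iff, Prod.forall, forall_comm]
  simp only [colBlock_mulVec, Pi.smul_apply, e]

lemma upper_relation_iff (P : Matrix (ι × ι) (ι × ι) R) (b : ι → R) :
    (∀ i j, b i * b j = s • ∑ h, ∑ k, b h * b k * P (h, k) (i, j)) ↔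
      Matrix.vecMul b (rowBlock b) = s • Matrix.vecMul (Matrix.vecMul b (rowBlock b)) P := by
  have e : ∀ p, Matrix.vecMul (Matrix.vecMul b (rowBlock b)) P p =
      ∑ h, ∑ k, b h * b k * P (h, k) p := fun p => by
    change ∑ q, Matrix.vecMul b (rowBlock b) q * P q p = _
    simp only [vecMul_rowBlock, Fintype.sum_prod_type]
  rw [funext_iff, Prod.forall]
  simp only [vecMul_rowBlock, Pi.smul_apply, e]

lemma mixed_relation_iff (P : Matrix (ι × ι) (ι × ι) R) (b d : ι → R) :
    (∀ i j, b i * d j = (if i = j then 1 else 0) +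
        s • ∑ h, ∑ k, d h * P (i, h) (j, k) * b k) ↔
      Matrix.vecMulVec b d = 1 + s • (rowBlock d * P * colBlock b) := by
  have e : ∀ i j, (rowBlock d * P * colBlock b) i j =
      ∑ h, ∑ k, d h * P (i, h) (j, k) * b k := fun i j => by
    simp only [mul_colBlock_apply, rowBlock_mul_apply, Finset.sum_mul]
    exact Finset.sum_comm
  rw [← Matrix.ext_iff]
  simp only [Matrix.vecMulVec_apply, Matrix.add_apply, Matrix.smul_apply, Matrix.one_apply, e]

end MatrixForm

end QHeis

end

theorem mainTheorem3
    {g : Type*} [LieRing g] [LieAlgebra ℂ g]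
    {ι : Type*} [Fintype ι] [DecidableEq ι] {κ : Type*}
    (s : ℤˣ) (ρ : g →ₗ⁅ℂ⁆ Matrix ι ι ℂ)
    (c : ι → κ) (hc : ∀ (x : g) (i j : ι), c i ≠ c j → ρ x i j = 0)
    (F : PowerSeries (QHeis.Ug2 g)) (hF : QHeis.IsTwist F)
    (φm : PowerSeries (QHeis.Ug3 g)) (hφm : QHeis.IsMinimalCoassociator g φm)
    (hmin : QHeis.coassociator F = φm)
    (U V : Matrix (ι × ι) (ι × ι) (PowerSeries ℂ))
    (hU : QHeis.CommutesWithCoproduct ρ U) (hV : QHeis.CommutesWithCoproduct ρ V)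
    (u uHat v vHat : κ → PowerSeries (QHeis.Heis ι s))
    (hu : ∀ b, QHeis.IsDressing s ρ (u b)) (huHat : ∀ b, QHeis.IsDressing s ρ (uHat b))
    (hv : ∀ b, QHeis.IsDressing s ρ (v b)) (hvHat : ∀ b, QHeis.IsDressing s ρ (vHat b))
    (a aPlus A APlus : ι → PowerSeries (QHeis.Heis ι s))
    (ha : a = QHeis.dressedLow s c u uHat) (haPlus : aPlus = QHeis.dressedUp s c v vHat)
    (hA : A = QHeis.deformedLow s ρ F a) (hAPlus : APlus = QHeis.deformedUp s ρ F aPlus)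
    (PF PFtilde : Matrix (ι × ι) (ι × ι) (PowerSeries ℂ))
    (hPF : PF = QHeis.twistedMatrix ρ F U) (hPFtilde : PFtilde = QHeis.twistedMatrix ρ F V)
    (M : Matrix (ι × ι) (ι × ι) (PowerSeries (QHeis.Heis ι s)))
    (hM : M = QHeis.rhoRhoSigma s ρ φm) :
    ((∀ i j, A i * A j =
        (s : ℤ) • ∑ h, ∑ k, QHeis.scal (PF (j, i) (h, k)) * (A k * A h)) ↔
      (∀ i j, a i * a j =
        (s : ℤ) • ∑ l, ∑ m, QHeis.dressedMatrix M U (j, i) (l, m) * (a m * a l))) ∧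
    ((∀ i j, APlus i * APlus j =
        (s : ℤ) • ∑ h, ∑ k, QHeis.scal (PF (h, k) (i, j)) * (APlus h * APlus k)) ↔
      (∀ i j, aPlus i * aPlus j =
        (s : ℤ) • ∑ l, ∑ m, aPlus l * aPlus m * QHeis.dressedMatrix M U (l, m) (i, j))) ∧
    ((∀ i j, A i * APlus j = (if i = j then 1 else 0) +
        (s : ℤ) • ∑ h, ∑ k, QHeis.scal (PFtilde (i, h) (j, k)) * (APlus h * A k)) ↔
      (∀ i j, a i * aPlus j = (if i = j then 1 else 0) +
        (s : ℤ) • ∑ l, ∑ m, aPlus l * QHeis.dressedMatrix M V (i, l) (j, m) * a m)) := by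
  have hFu : IsUnit F := QHeis.isUnit_of_constantCoeff_eq_one hF.const
  subst hmin hM hPF hPFtilde hA hAPlus
  have hlow : ∀ N, QHeis.IsLowerTensor s ρ fun i => PowerSeries.coeff N (a i) := by
    subst ha
    exact QHeis.isLowerTensor_coeff_dressedLow hc (fun b => (hu b).1) fun b => (huHat b).1
  have hup : ∀ N, QHeis.IsUpperTensor s ρ fun i => PowerSeries.coeff N (aPlus i) := by
    subst haPlus
    exact QHeis.isUpperTensor_coeff_dressedUp hc (fun b => (hv b).1) fun b => (hvHat b).1
  have hQ := QHeis.towerMatrix_mul_towerInv s ρ hFu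
  have hQ' := QHeis.towerInv_mul_towerMatrix s ρ hFu
  have hN : QHeis.rhoSigma s ρ F * QHeis.rhoSigma s ρ (Ring.inverse F) = 1 := by
    rw [QHeis.rhoSigma_eq_matSeries, QHeis.rhoSigma_eq_matSeries, ← map_mul,
      Ring.mul_inverse_cancel F hFu, map_one]
  have hN' : QHeis.rhoSigma s ρ (Ring.inverse F) * QHeis.rhoSigma s ρ F = 1 := by
    rw [QHeis.rhoSigma_eq_matSeries, QHeis.rhoSigma_eq_matSeries, ← map_mul,
      Ring.inverse_mul_cancel F hFu, map_one]
  have hscal : ∀ (x : PowerSeries ℂ) (p q : PowerSeries (QHeis.Heis ι s)),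
      QHeis.scal x * (p * q) = p * QHeis.scal x * q := fun x p q => by
    rw [← mul_assoc, (QHeis.scal_commute x p).eq]
  refine ⟨?_, ?_, ?_⟩
  · rw [QHeis.lower_relation_iff, QHeis.dressedMatrix_coassociator s ρ hFu hU,
      ← QHeis.mulVec_relation_iff s hQ hQ', ← QHeis.colBlock_mulVec_deformedLow hlow,
      ← QHeis.lower_relation_iff]
    rfl
  · simp only [(QHeis.scal_commute _ _).eq]
    rw [QHeis.upper_relation_iff, QHeis.dressedMatrix_coassociator s ρ hFu hU,
      ← QHeis.vecMul_relation_iff s hQ hQ', ← QHeis.vecMul_rowBlock_deformedUp hup,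
      ← QHeis.upper_relation_iff]
    rfl
  · simp only [hscal]
    rw [QHeis.mixed_relation_iff, QHeis.dressedMatrix_coassociator s ρ hFu hV,
      ← QHeis.conj_relation_iff s hN hN' (QHeis.rowBlock_mul_colBlock_deformed hlow hup _),
      ← QHeis.vecMulVec_deformed, ← QHeis.mixed_relation_iff]
    rfl
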